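/- Let $U$ be a path-connected topological space having the homotopy type of a CW complex, let $u\in U$, and let $G=\pi_1(U,u)$. Let $n\ge 0$ be an integer and suppose that 1. the abelianization $G/G'$ is a free abelian group of rank $n$; 2. $G$ can be generated by $n$ elements; 3. the homomorphism $H_2(U;\mathbb{Z})\to H_1(U;\mathbb{Z})\otimes_{\mathbb{Z}} H_1(U;\mathbb{Z})$ induced by the (Alexander–Whitney) comultiplication of the singular chain complex of $U$ is injective. Let $\gamma_1G=G$ and $\gamma_{k+1}G=(G,\gamma_kG)$ be the lower central series of $G$, and let $I$ be the augmentation ideal of the group ring $\mathbb{Z}G$, that is, the kernel of the ring homomorphism $\mathbb{Z}G\to\mathbb{Z}$ sending every $g\in G$ to $1$. Then for $k=1,2,3,4$ $$\gamma_kG=\{\,g\in G : g-1\in I^k\,\}.$$ -/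

import Mathlib

open CategoryTheory Simplicial TensorProduct

universe u

noncomputable section

/-! ### Integral chains of a simplicial set -/

/-- The free abelian group of `n`-chains of the simplicial set `X`. -/
abbrev SChain (X : SSet.{u}) (n : ℕ) : Type u := (X _⦋n⦌) →₀ ℤ

/-- The boundary `∂ = ∑ (-1)^i d_i : C_{n+1} → C_n`. -/
def sBoundary (X : SSet.{u}) (n : ℕ) : SChain X (n + 1) →ₗ[ℤ] SChain X n :=
  ∑ i : Fin (n + 2), (-1 : ℤ) ^ (i : ℕ) • Finsupp.lmapDomain ℤ ℤ (fun σ => X.δ i σ)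

/-- The homology `H_{n+1}(X; ℤ) = ker (C_{n+1} → C_n) / im (C_{n+2} → C_{n+1})`. -/
abbrev SHomologySucc (X : SSet.{u}) (n : ℕ) : Type u :=
  LinearMap.ker (sBoundary X n) ⧸
    (LinearMap.range (sBoundary X (n + 1))).submoduleOf (LinearMap.ker (sBoundary X n))

/-- The component `C_2 → C_1 ⊗ C_1` of the Alexander–Whitney comultiplication: a `2`-simplex with
vertices `0, 1, 2` goes to (front edge `01`) `⊗` (back edge `12`). -/
def alexanderWhitney (X : SSet.{u}) : SChain X 2 →ₗ[ℤ] SChain X 1 ⊗[ℤ] SChain X 1 :=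
  Finsupp.linearCombination ℤ fun σ =>
    Finsupp.single (X.δ 2 σ) (1 : ℤ) ⊗ₜ[ℤ] Finsupp.single (X.δ 0 σ) (1 : ℤ)

/-- `ρ : C_1 → H_1` is a retraction if it sends every `1`-cycle to its homology class. Since `ρ`
kills boundaries, it is (together with the augmentation in degree `0`) the low-degree part of a
chain map from the chains to their homology which induces the identity on `H_1`. -/
def IsHomologyRetraction (X : SSet.{u}) (ρ : SChain X 1 →ₗ[ℤ] SHomologySucc X 0) : Prop :=
  ∀ z : LinearMap.ker (sBoundary X 0), ρ z = Submodule.Quotient.mk z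

lemma sBoundary_zero_single (X : SSet.{u}) (σ : X _⦋1⦌) :
    sBoundary X 0 (Finsupp.single σ 1) =
      Finsupp.single (X.δ 0 σ) 1 - Finsupp.single (X.δ 1 σ) 1 := by
  simp [sBoundary, Fin.sum_univ_succ, Finsupp.mapDomain_single, sub_eq_add_neg]

lemma sBoundary_one_single (X : SSet.{u}) (σ : X _⦋2⦌) :
    sBoundary X 1 (Finsupp.single σ 1) =
      Finsupp.single (X.δ 0 σ) 1 - Finsupp.single (X.δ 1 σ) 1 + Finsupp.single (X.δ 2 σ) 1 := by
  simp only [sBoundary, LinearMap.sum_apply, LinearMap.smul_apply, Finsupp.lmapDomain_apply,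
    Finsupp.mapDomain_single]
  rw [Fin.sum_univ_three]
  simp [sub_eq_add_neg]

lemma sBoundary_two_single (X : SSet.{u}) (σ : X _⦋3⦌) :
    sBoundary X 2 (Finsupp.single σ 1) =
      Finsupp.single (X.δ 0 σ) 1 - Finsupp.single (X.δ 1 σ) 1 + Finsupp.single (X.δ 2 σ) 1
        - Finsupp.single (X.δ 3 σ) 1 := by
  simp only [sBoundary, LinearMap.sum_apply, LinearMap.smul_apply, Finsupp.lmapDomain_apply,
    Finsupp.mapDomain_single]
  rw [Fin.sum_univ_four]
  simp [sub_eq_add_neg, pow_succ]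

lemma sδ_comm (X : SSet.{u}) {n : ℕ} (i j : Fin (n + 2)) (h : i ≤ j) (σ : X _⦋n + 2⦌) :
    X.δ i (X.δ j.succ σ) = X.δ j (X.δ i.castSucc σ) :=
  ConcreteCategory.congr_hom (X.δ_comp_δ h) σ

lemma sBoundary_zero_one (X : SSet.{u}) (c : SChain X 2) :
    sBoundary X 0 (sBoundary X 1 c) = 0 := by
  suffices h : (sBoundary X 0) ∘ₗ (sBoundary X 1) = 0 from LinearMap.congr_fun h c
  refine Finsupp.lhom_ext' fun σ => LinearMap.ext_ring ?_
  have h1 : X.δ 0 (X.δ 1 σ) = X.δ 0 (X.δ 0 σ) := sδ_comm X 0 0 le_rfl σ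
  have h2 : X.δ 0 (X.δ 2 σ) = X.δ 1 (X.δ 0 σ) := sδ_comm X 0 1 (by decide) σ
  have h3 : X.δ 1 (X.δ 2 σ) = X.δ 1 (X.δ 1 σ) := sδ_comm X 1 1 le_rfl σ
  change sBoundary X 0 (sBoundary X 1 (Finsupp.single σ 1)) = 0
  rw [sBoundary_one_single, map_add, map_sub, sBoundary_zero_single, sBoundary_zero_single,
    sBoundary_zero_single, h1, h2, h3]
  abel

/-- A retraction kills boundaries. -/
lemma IsHomologyRetraction.boundary {X : SSet.{u}} {ρ : SChain X 1 →ₗ[ℤ] SHomologySucc X 0}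
    (hρ : IsHomologyRetraction X ρ) (c : SChain X 2) : ρ (sBoundary X 1 c) = 0 := by
  rw [hρ ⟨sBoundary X 1 c, sBoundary_zero_one X c⟩, Submodule.Quotient.mk_eq_zero]
  exact ⟨c, rfl⟩

lemma IsHomologyRetraction.face {X : SSet.{u}} {ρ : SChain X 1 →ₗ[ℤ] SHomologySucc X 0}
    (hρ : IsHomologyRetraction X ρ) (σ : X _⦋2⦌) :
    ρ (Finsupp.single (X.δ 1 σ) 1) =
      ρ (Finsupp.single (X.δ 2 σ) 1) + ρ (Finsupp.single (X.δ 0 σ) 1) := by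
  have h := hρ.boundary (Finsupp.single σ 1)
  rw [sBoundary_one_single, map_add, map_sub] at h
  rw [← sub_eq_zero, ← neg_eq_zero, ← h]
  abel

lemma alexanderWhitney_single (X : SSet.{u}) (σ : X _⦋2⦌) :
    alexanderWhitney X (Finsupp.single σ 1) =
      Finsupp.single (X.δ 2 σ) (1 : ℤ) ⊗ₜ[ℤ] Finsupp.single (X.δ 0 σ) (1 : ℤ) := by
  simp [alexanderWhitney]

lemma IsHomologyRetraction.comult_boundary {X : SSet.{u}}
    {ρ : SChain X 1 →ₗ[ℤ] SHomologySucc X 0} (hρ : IsHomologyRetraction X ρ) (c : SChain X 3) :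
    TensorProduct.map ρ ρ (alexanderWhitney X (sBoundary X 2 c)) = 0 := by
  suffices h : TensorProduct.map ρ ρ ∘ₗ alexanderWhitney X ∘ₗ sBoundary X 2 = 0 from
    LinearMap.congr_fun h c
  refine Finsupp.lhom_ext' fun σ => LinearMap.ext_ring ?_
  have h00 : X.δ 0 (X.δ 1 σ) = X.δ 0 (X.δ 0 σ) := sδ_comm X 0 0 (by decide) σ
  have h01 : X.δ 0 (X.δ 2 σ) = X.δ 1 (X.δ 0 σ) := sδ_comm X 0 1 (by decide) σ
  have h02 : X.δ 0 (X.δ 3 σ) = X.δ 2 (X.δ 0 σ) := sδ_comm X 0 2 (by decide) σ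
  have h12 : X.δ 1 (X.δ 3 σ) = X.δ 2 (X.δ 1 σ) := sδ_comm X 1 2 (by decide) σ
  have h22 : X.δ 2 (X.δ 3 σ) = X.δ 2 (X.δ 2 σ) := sδ_comm X 2 2 (by decide) σ
  have f0 := hρ.face (X.δ 0 σ)
  have f3 := hρ.face (X.δ 3 σ)
  rw [h12, h22, h02] at f3
  change TensorProduct.map ρ ρ (alexanderWhitney X (sBoundary X 2 (Finsupp.single σ 1))) = 0
  rw [sBoundary_two_single]
  simp only [map_add, map_sub, alexanderWhitney_single, TensorProduct.map_tmul, h00, h01, h02, h22,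
    f0, f3, TensorProduct.tmul_add, TensorProduct.add_tmul]
  abel

/-- The homomorphism `H_2 → H_1 ⊗ H_1` that the comultiplication induces, computed with a
retraction `ρ`: the class of a cycle `z` goes to the image of `z` under
`C_2 → C_1 ⊗ C_1 → H_1 ⊗ H_1`. -/
def comultOf (X : SSet.{u}) (ρ : SChain X 1 →ₗ[ℤ] SHomologySucc X 0)
    (hρ : IsHomologyRetraction X ρ) :
    SHomologySucc X 1 →ₗ[ℤ] SHomologySucc X 0 ⊗[ℤ] SHomologySucc X 0 :=
  Submodule.liftQ _
    ((TensorProduct.map ρ ρ ∘ₗ alexanderWhitney X) ∘ₗ (LinearMap.ker (sBoundary X 1)).subtype) <| by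
    rintro z ⟨c, hc⟩
    rw [LinearMap.mem_ker, LinearMap.comp_apply, ← hc]
    exact hρ.comult_boundary c

/-- `X` is based at `v` if every vertex is joined to `v` by an edge. -/
def EdgeBased (X : SSet.{u}) (v : X _⦋0⦌) : Prop := ∀ x : X _⦋0⦌, Nonempty (SSet.Edge v x)

/-- Retractions exist. -/
lemma EdgeBased.exists_retraction {X : SSet.{u}} {v : X _⦋0⦌} (h : EdgeBased X v) :
    ∃ ρ, IsHomologyRetraction X ρ := by
  let e := fun x => (h x).some
  let E : SChain X 0 →ₗ[ℤ] SChain X 1 :=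
    Finsupp.linearCombination ℤ fun x => Finsupp.single (e x).edge 1
  let P : SChain X 1 →ₗ[ℤ] SChain X 1 := LinearMap.id - E ∘ₗ sBoundary X 0
  have hP : ∀ c, sBoundary X 0 (P c) = 0 := by
    intro c
    suffices h : sBoundary X 0 ∘ₗ P = 0 from LinearMap.congr_fun h c
    refine Finsupp.lhom_ext' fun σ => LinearMap.ext_ring ?_
    simp [P, E, sBoundary_zero_single]
  refine ⟨Submodule.mkQ _ ∘ₗ P.codRestrict (LinearMap.ker (sBoundary X 0)) hP, fun z => ?_⟩
  have hz : P z = z := by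
    have := z.2
    rw [LinearMap.mem_ker] at this
    simp [P, this]
  simp only [LinearMap.comp_apply, Submodule.mkQ_apply]
  congr 1
  exact Subtype.ext hz

/-- The induced homomorphism does not depend on the retraction. -/
lemma EdgeBased.comultOf_eq {X : SSet.{u}} {v : X _⦋0⦌} (h : EdgeBased X v)
    {ρ ρ' : SChain X 1 →ₗ[ℤ] SHomologySucc X 0}
    (hρ : IsHomologyRetraction X ρ) (hρ' : IsHomologyRetraction X ρ') :
    comultOf X ρ hρ = comultOf X ρ' hρ' := by
  let e := fun x => (h x).some
  let s : X _⦋0⦌ → SHomologySucc X 0 := fun x =>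
    ρ (Finsupp.single (e x).edge 1) - ρ' (Finsupp.single (e x).edge 1)
  have hs : ∀ σ : X _⦋1⦌, ρ (Finsupp.single σ 1) =
      ρ' (Finsupp.single σ 1) + (s (X.δ 0 σ) - s (X.δ 1 σ)) := by
    intro σ
    let c : SChain X 1 := Finsupp.single (e (X.δ 1 σ)).edge 1 + Finsupp.single σ 1
      - Finsupp.single (e (X.δ 0 σ)).edge 1
    have hc : sBoundary X 0 c = 0 := by simp [c, sBoundary_zero_single]
    have := (hρ ⟨c, hc⟩).trans (hρ' ⟨c, hc⟩).symm
    simp only [c, map_add, map_sub] at this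
    simp only [s]
    rw [← sub_eq_zero] at this ⊢
    rw [← this]
    abel
  let T : SChain X 1 →ₗ[ℤ] SHomologySucc X 0 ⊗[ℤ] SHomologySucc X 0 :=
    Finsupp.linearCombination ℤ fun σ =>
      s (X.δ 1 σ) ⊗ₜ ρ (Finsupp.single σ 1) - ρ' (Finsupp.single σ 1) ⊗ₜ s (X.δ 0 σ)
  have hT : ∀ c : SChain X 2, TensorProduct.map ρ ρ (alexanderWhitney X c) =
      TensorProduct.map ρ' ρ' (alexanderWhitney X c) + T (sBoundary X 1 c) := by
    intro c
    induction c using Finsupp.induction_linear with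
    | zero => simp only [map_zero, add_zero]
    | add c d hc hd =>
      simp only [map_add] at hc hd ⊢
      rw [hc, hd]
      abel
    | single σ a =>
    suffices h : TensorProduct.map ρ ρ (alexanderWhitney X (Finsupp.single σ 1)) =
        TensorProduct.map ρ' ρ' (alexanderWhitney X (Finsupp.single σ 1)) +
          T (sBoundary X 1 (Finsupp.single σ 1)) by
      have ha : Finsupp.single σ a = a • (Finsupp.single σ 1 : SChain X 2) := by simp
      rw [ha]
      simp only [map_zsmul]
      rw [h, smul_add]
    have h1 : X.δ 0 (X.δ 1 σ) = X.δ 0 (X.δ 0 σ) := sδ_comm X 0 0 le_rfl σ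
    have h2 : X.δ 0 (X.δ 2 σ) = X.δ 1 (X.δ 0 σ) := sδ_comm X 0 1 (by decide) σ
    have h3 : X.δ 1 (X.δ 2 σ) = X.δ 1 (X.δ 1 σ) := sδ_comm X 1 1 le_rfl σ
    have f := hρ'.face σ
    rw [sBoundary_one_single]
    simp only [alexanderWhitney_single, TensorProduct.map_tmul, map_add, map_sub, T,
      Finsupp.linearCombination_single, one_smul, hs, f, h1, h2, h3,
      TensorProduct.tmul_add, TensorProduct.add_tmul, TensorProduct.tmul_sub,
      TensorProduct.sub_tmul]
    abel
  refine Submodule.linearMap_qext _ (LinearMap.ext fun z => ?_)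
  have hz := z.2
  rw [LinearMap.mem_ker] at hz
  have := hT z
  rw [hz, map_zero, add_zero] at this
  exact this

/-! ### Singular homology of a space in degrees one and two -/

/-- The singular simplicial set of a topological space. -/
abbrev Sing (U : Type u) [TopologicalSpace U] : SSet.{u} := TopCat.toSSet.obj (TopCat.of U)

/-- Singular homology `H_1(U; ℤ)`. -/
abbrev SingH₁ (U : Type u) [TopologicalSpace U] : Type u := SHomologySucc (Sing U) 0

/-- Singular homology `H_2(U; ℤ)`. -/
abbrev SingH₂ (U : Type u) [TopologicalSpace U] : Type u := SHomologySucc (Sing U) 1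

lemma exists_edgeBased (U : Type u) [TopologicalSpace U] [PathConnectedSpace U] :
    ∃ v, EdgeBased (Sing U) v := by
  obtain ⟨u⟩ := (inferInstance : Nonempty U)
  refine ⟨TopCat.toSSetObj₀Equiv.symm u, fun x => ?_⟩
  obtain ⟨x, rfl⟩ := TopCat.toSSetObj₀Equiv.symm.surjective x
  exact ⟨TopCat.toSSetObjEdgeEquiv.symm (TopCat.pathEquiv.symm (PathConnectedSpace.somePath u x))⟩

lemma exists_singRetraction (U : Type u) [TopologicalSpace U] [PathConnectedSpace U] :
    ∃ ρ, IsHomologyRetraction (Sing U) ρ :=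
  (exists_edgeBased U).choose_spec.exists_retraction

/-- The homomorphism `H_2(U) → H_1(U) ⊗ H_1(U)` induced by the comultiplication of the singular
chains of a path-connected space `U`. -/
def singComult (U : Type u) [TopologicalSpace U] [PathConnectedSpace U] :
    SingH₂ U →ₗ[ℤ] SingH₁ U ⊗[ℤ] SingH₁ U :=
  comultOf (Sing U) (exists_singRetraction U).choose (exists_singRetraction U).choose_spec

/-- The homomorphism `singComult` can be computed with any retraction. -/
lemma singComult_eq (U : Type u) [TopologicalSpace U] [PathConnectedSpace U]
    {ρ : SChain (Sing U) 1 →ₗ[ℤ] SingH₁ U} (hρ : IsHomologyRetraction (Sing U) ρ) :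
    singComult U = comultOf (Sing U) ρ hρ :=
  (exists_edgeBased U).choose_spec.comultOf_eq _ hρ

/-- `U` has the homotopy type of a CW complex. -/
def HasCWHomotopyType (U : Type u) [TopologicalSpace U] : Prop :=
  ∃ (Y : Type u) (_ : TopologicalSpace Y), T2Space Y ∧
    Nonempty (Topology.CWComplex (Set.univ : Set Y)) ∧ Nonempty (ContinuousMap.HomotopyEquiv U Y)

/-! ### The group ring -/

/-- The augmentation ideal of the group ring `ℤ[G]`: the kernel of the ring homomorphism
`ℤ[G] → ℤ` which sends every `g : G` to `1`. -/
def augmentationIdeal (G : Type u) [Group G] : Ideal (MonoidAlgebra ℤ G) :=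
  RingHom.ker (MonoidAlgebra.lift ℤ ℤ G (1 : G →* ℤ))

end

/-! The inclusion of γ_k in the k-th dimension subgroup D_k is the classical commutator computation
in the group ring. Conversely, passing to H = G/γ_k, it suffices that D_k(H) is trivial. Elements of
D_k cannot be separated from 1 by polynomial functions of degree < k with values in abelian groups
(`IsPolyLT.linExt_eq_zero`), so enough such functions are needed.

They are built on the free group F on the n generators. A surjective endomorphism of ℤ^n is
injective, so all relations lie in F' (`magnus₁_eq_zero_of_mem_commutator`). A polynomial function f
on F that is additive along the kernel R of π : F → H descends to H modulo the subgroup f(R). Hence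
if π w lies in D_k(H), then f(w) = f(r) for some r in R, and w may be replaced by w r⁻¹, where f
vanishes (`exists_mem_ker_eq_of_mem_dimensionSubgroup`).

For k = 2, 3 the Magnus coefficients of degree < k are such functions, and their vanishing puts the
word in γ_k F. For k = 4 one more function is needed, with values in the center of H, which agrees
with π on γ_3 F (`exists_isPolyLT_eq_centerValue`). It pairs the cubic Magnus coefficients with a
tensor φ symmetric in its last two indices and satisfying φ_abc - φ_bac = ⁅⁅x_a, x_b⁆, x_c⁆. Such φ
exists by antisymmetry and the Jacobi identity (`symmPreimage_sub`); its symmetry gives additivity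
along F'. -/

open scoped commutatorElement

/-! ### Polynomial functions on a group and powers of the augmentation ideal -/

/-- `f : G → B` is polynomial of degree `< k`: its `k`-fold iterated differences vanish. -/
def IsPolyLT {G B : Type*} [Group G] [AddCommGroup B] (k : ℕ) (f : G → B) :
    Prop :=
  match k with
  | 0 => ∀ g, f g = 0
  | k + 1 => ∀ h, IsPolyLT k fun g => f (g * h) - f g

namespace IsPolyLT

variable {G H B C : Type*} [Group G] [Group H] [AddCommGroup B] [AddCommGroup C]

lemma zero (k : ℕ) : IsPolyLT k (fun _ : G => (0 : B)) := by
  induction k with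
  | zero => intro g; rfl
  | succ k ih => intro h; simpa using ih

lemma const (k : ℕ) (b : B) : IsPolyLT (k + 1) (fun _ : G => b) := by
  intro h
  simpa using zero k

lemma add {k : ℕ} {f f' : G → B} (hf : IsPolyLT k f) (hf' : IsPolyLT k f') :
    IsPolyLT k (fun g => f g + f' g) := by
  induction k generalizing f f' with
  | zero => intro g; simp [hf g, hf' g]
  | succ k ih =>
    intro h
    convert ih (hf h) (hf' h) using 2
    exact add_sub_add_comm _ _ _ _

lemma sum {ι : Type*} {k : ℕ} (s : Finset ι) {f : ι → G → B} (hf : ∀ i, IsPolyLT k (f i)) :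
    IsPolyLT k (fun g => ∑ i ∈ s, f i g) := by
  classical
  induction s using Finset.induction_on with
  | empty => simpa using zero k
  | insert a s ha ih => simpa [Finset.sum_insert ha] using (hf a).add ih

lemma map {k : ℕ} {f : G → B} (hf : IsPolyLT k f) (φ : B →+ C) :
    IsPolyLT k (fun g => φ (f g)) := by
  induction k generalizing f with
  | zero => intro g; simp [hf g]
  | succ k ih => intro h; simpa using ih (hf h)

lemma smul_const {k : ℕ} {f : G → ℤ} (hf : IsPolyLT k f) (b : B) :
    IsPolyLT k (fun g => f g • b) := by
  simpa using hf.map (zmultiplesHom B b)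

lemma mul_const {k : ℕ} {f : G → ℤ} (hf : IsPolyLT k f) (b : ℤ) :
    IsPolyLT k (fun g => f g * b) := by
  simpa using hf.smul_const b

lemma prodMk {k : ℕ} {f : G → B} {f' : G → C} (hf : IsPolyLT k f) (hf' : IsPolyLT k f') :
    IsPolyLT k (fun g => (f g, f' g)) := by
  simpa using (hf.map (AddMonoidHom.inl B C)).add (hf'.map (AddMonoidHom.inr B C))

lemma pi {ι : Type*} {k : ℕ} {f : ι → G → B} (hf : ∀ i, IsPolyLT k (f i)) :
    IsPolyLT k (fun g i => f i g) := by
  induction k generalizing f with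
  | zero => intro g; ext i; exact hf i g
  | succ k ih => intro h; exact ih fun i => hf i h

lemma succ {k : ℕ} {f : G → B} (hf : IsPolyLT k f) : IsPolyLT (k + 1) f := by
  induction k generalizing f with
  | zero => intro h g; simp [hf (g * h), hf g]
  | succ k ih => intro h; exact ih (hf h)

/-- Increments in `G` lift to `H`, so iterated differences can be computed upstairs. -/
lemma of_comp {k : ℕ} {π : H →* G} (hπ : Function.Surjective π) {f : G → B}
    (hf : IsPolyLT k fun x => f (π x)) : IsPolyLT k f := by
  induction k generalizing f with
  | zero => intro g; obtain ⟨x, rfl⟩ := hπ g; exact hf x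
  | succ k ih =>
    intro h
    obtain ⟨y, rfl⟩ := hπ h
    refine ih ?_
    simpa using hf y

end IsPolyLT

/-- The `ℤ`-linear extension to the group ring of a function on a group. -/
noncomputable def linExt {G B : Type*} [AddCommGroup B] (f : G → B) :
    MonoidAlgebra ℤ G →ₗ[ℤ] B :=
  Finsupp.linearCombination ℤ f ∘ₗ (MonoidAlgebra.coeffLinearEquiv ℤ).toLinearMap

section LinExt

variable {G B : Type*} [AddCommGroup B]

lemma linExt_single (f : G → B) (g : G) (a : ℤ) :
    linExt f (MonoidAlgebra.single g a) = a • f g := by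
  simp [linExt, MonoidAlgebra.coeffLinearEquiv]

lemma linExt_sub (f f' : G → B) (x : MonoidAlgebra ℤ G) :
    linExt (fun g => f g - f' g) x = linExt f x - linExt f' x := by
  induction x using MonoidAlgebra.induction_linear with
  | zero => simp
  | add x y hx hy => rw [map_add, hx, hy, map_add, map_add]; abel
  | single g b => simp [linExt_single, smul_sub]

variable [Group G]

lemma linExt_one (f : G → B) : linExt f 1 = f 1 := by
  rw [MonoidAlgebra.one_def, linExt_single, one_smul]

lemma linExt_mul_of (f : G → B) (x : MonoidAlgebra ℤ G) (h : G) (a : ℤ) :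
    linExt f (x * MonoidAlgebra.single h a) = a • linExt (fun g => f (g * h)) x := by
  induction x using MonoidAlgebra.induction_linear with
  | zero => simp
  | add x y hx hy => rw [add_mul, map_add, hx, hy, map_add, smul_add]
  | single g b =>
    rw [MonoidAlgebra.single_mul_single, linExt_single, linExt_single, smul_smul, mul_comm]

end LinExt

/-! ### Dimension subgroups -/

section AugmentationIdeal

variable {G : Type u} {B : Type*} [Group G] [AddCommGroup B]

instance : (augmentationIdeal G).IsTwoSided := by
  unfold augmentationIdeal
  infer_instance

/-- Right multiplication by h - 1 on the group ring is dual to the difference operator in direction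
h, so each factor from the augmentation ideal lowers the degree by one. -/
lemma IsPolyLT.linExt_eq_zero {k : ℕ} {f : G → B} (hf : IsPolyLT k f) {x : MonoidAlgebra ℤ G}
    (hx : x ∈ augmentationIdeal G ^ k) : linExt f x = 0 := by
  induction k generalizing f x with
  | zero =>
    have : f = 0 := funext hf
    induction x using MonoidAlgebra.induction_linear with
    | zero => simp
    | add x y hx hy => simp_all [Submodule.pow_zero]
    | single g b => simp [linExt_single, this]
  | succ k ih =>
    rw [Submodule.pow_succ] at hx
    refine Submodule.mul_induction_on hx (fun x hx y hy => ?_) (fun x y hx hy => ?_)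
    -- By induction all right translates of `f` agree on `x`, so only the augmentation of `y`
    -- matters.
    · have key : ∀ y : MonoidAlgebra ℤ G, linExt f (x * y) =
          MonoidAlgebra.lift ℤ ℤ G (1 : G →* ℤ) y • linExt f x := by
        intro y
        induction y using MonoidAlgebra.induction_linear with
        | zero => simp
        | add y z hy hz => rw [mul_add, map_add, hy, hz, map_add, add_smul]
        | single h a =>
          have := ih (hf h) hx
          rw [linExt_sub, sub_eq_zero] at this
          rw [linExt_mul_of, this]
          simp
      rw [key, show MonoidAlgebra.lift ℤ ℤ G (1 : G →* ℤ) y = 0 from hy, zero_smul]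
    · rw [map_add, hx, hy, add_zero]

lemma of_sub_one_mem_augmentationIdeal (g : G) :
    MonoidAlgebra.of ℤ G g - 1 ∈ augmentationIdeal G := by
  simp [augmentationIdeal, RingHom.mem_ker]

/-- The `k`-th integral dimension subgroup of `G`. -/
def dimensionSubgroup (G : Type u) [Group G] (k : ℕ) : Subgroup G where
  carrier := {g | MonoidAlgebra.of ℤ G g - 1 ∈ augmentationIdeal G ^ k}
  one_mem' := by
    rw [Set.mem_ofPred_eq, map_one, sub_self]
    exact zero_mem _
  mul_mem' {a b} ha hb := by
    have : MonoidAlgebra.of ℤ G (a * b) - 1 =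
        MonoidAlgebra.of ℤ G a * (MonoidAlgebra.of ℤ G b - 1) + (MonoidAlgebra.of ℤ G a - 1) := by
      rw [map_mul, mul_sub]; noncomm_ring
    rw [Set.mem_ofPred_eq, this]
    exact add_mem (Ideal.mul_mem_left _ _ hb) ha
  inv_mem' {a} ha := by
    have : MonoidAlgebra.of ℤ G a⁻¹ - 1 =
        -(MonoidAlgebra.of ℤ G a⁻¹ * (MonoidAlgebra.of ℤ G a - 1)) := by
      rw [mul_sub, ← map_mul, inv_mul_cancel, map_one, mul_one, neg_sub]
    rw [Set.mem_ofPred_eq, this]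
    exact neg_mem (Ideal.mul_mem_left _ _ ha)

lemma mem_dimensionSubgroup {k : ℕ} {g : G} : g ∈ dimensionSubgroup G k ↔
    MonoidAlgebra.of ℤ G g - 1 ∈ augmentationIdeal G ^ k := Iff.rfl

lemma lowerCentralSeries_le_dimensionSubgroup (k : ℕ) :
    (⊤ : Subgroup G).lowerCentralSeries k ≤ dimensionSubgroup G (k + 1) := by
  induction k with
  | zero =>
    intro g _
    rw [mem_dimensionSubgroup, zero_add, Submodule.pow_one]
    exact of_sub_one_mem_augmentationIdeal g
  | succ k ih =>
    rw [Subgroup.lowerCentralSeries_succ, Subgroup.commutator_le]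
    intro g hg h _
    have hg' := ih hg
    rw [mem_dimensionSubgroup] at hg' ⊢
    have hh := of_sub_one_mem_augmentationIdeal h
    -- The ring commutators of g, h and of g - 1, h - 1 coincide.
    have e : MonoidAlgebra.of ℤ G ⁅g, h⁆ - 1 =
        ((MonoidAlgebra.of ℤ G g - 1) * (MonoidAlgebra.of ℤ G h - 1) -
          (MonoidAlgebra.of ℤ G h - 1) * (MonoidAlgebra.of ℤ G g - 1)) *
            MonoidAlgebra.of ℤ G (g⁻¹ * h⁻¹) := by
      have h1 : MonoidAlgebra.of ℤ G ⁅g, h⁆ = MonoidAlgebra.of ℤ G g * MonoidAlgebra.of ℤ G h *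
          MonoidAlgebra.of ℤ G (g⁻¹ * h⁻¹) := by
        simp only [← map_mul, commutatorElement_def, mul_assoc]
      have h2 : MonoidAlgebra.of ℤ G h * MonoidAlgebra.of ℤ G g *
          MonoidAlgebra.of ℤ G (g⁻¹ * h⁻¹) = 1 := by
        rw [← map_mul, ← map_mul, mul_assoc, mul_inv_cancel_left, mul_inv_cancel, map_one]
      rw [h1]
      nth_rewrite 1 [← h2]
      noncomm_ring
    rw [e]
    refine Ideal.mul_mem_right _ _ (sub_mem ?_ ?_)
    · rw [Submodule.pow_succ]
      exact Ideal.mul_mem_mul hg' hh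
    · rw [Ideal.IsTwoSided.pow_succ]
      exact Ideal.mul_mem_mul hh hg'

lemma dimensionSubgroup_map {H : Type u} [Group H] (π : G →* H) {k : ℕ} {g : G}
    (hg : g ∈ dimensionSubgroup G k) : π g ∈ dimensionSubgroup H k := by
  rw [mem_dimensionSubgroup] at hg ⊢
  let P := MonoidAlgebra.mapDomainRingHom ℤ π
  have hP : ∀ g, P (MonoidAlgebra.of ℤ G g) = MonoidAlgebra.of ℤ H (π g) := by
    intro g; simp [P]
  have h1 : ∀ x ∈ augmentationIdeal G, P x ∈ augmentationIdeal H := by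
    intro x hx
    have : ∀ x, MonoidAlgebra.lift ℤ ℤ H (1 : H →* ℤ) (P x) =
        MonoidAlgebra.lift ℤ ℤ G (1 : G →* ℤ) x := by
      intro x
      induction x using MonoidAlgebra.induction_linear with
      | zero => simp
      | add x y hx hy => simp only [map_add, hx, hy]
      | single g b => simp [P]
    exact (this x).trans hx
  have h2 : ∀ k, ∀ x ∈ augmentationIdeal G ^ k, P x ∈ augmentationIdeal H ^ k := by
    intro k
    induction k with
    | zero => intro x _; simp [Submodule.pow_zero]
    | succ k ih =>
      intro x hx
      rw [Submodule.pow_succ] at hx ⊢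
      refine Submodule.mul_induction_on hx (fun x hx y hy => ?_) (fun x y hx hy => ?_)
      · rw [map_mul]; exact Ideal.mul_mem_mul (ih x hx) (h1 y hy)
      · rw [map_add]; exact add_mem hx hy
  have := h2 k _ hg
  rwa [map_sub, hP, map_one] at this

/-- A polynomial function `f` on `F` which is additive along the kernel of a surjection
`π : F → H` takes on preimages of dimension subgroups of `H` only values taken on the kernel. -/
lemma exists_mem_ker_eq_of_mem_dimensionSubgroup {F : Type*} {H : Type u} [Group F] [Group H]
    {π : F →* H} (hπ : Function.Surjective π) {k : ℕ} {f : F → B} (hf : IsPolyLT k f)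
    (hker : ∀ w, ∀ r ∈ π.ker, f (w * r) = f w + f r) {w : F}
    (hw : π w ∈ dimensionSubgroup H k) : ∃ r ∈ π.ker, f w = f r := by
  have hf1 : f 1 = 0 := by simpa using hker 1 1 (one_mem _)
  -- Additivity along the kernel makes its image a subgroup; modulo `K` the function is constant on
  -- fibres of `π` and descends to `H`.
  let K : AddSubgroup B :=
    { carrier := f '' π.ker
      zero_mem' := ⟨1, one_mem _, hf1⟩
      add_mem' := by
        rintro _ _ ⟨r, hr, rfl⟩ ⟨s, hs, rfl⟩
        exact ⟨r * s, mul_mem hr hs, hker r s hs⟩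
      neg_mem' := by
        rintro _ ⟨r, hr, rfl⟩
        refine ⟨r⁻¹, inv_mem hr, ?_⟩
        have := hker r r⁻¹ (inv_mem hr)
        rw [mul_inv_cancel, hf1] at this
        exact (neg_eq_of_add_eq_zero_right this.symm).symm }
  let s := Function.surjInv hπ
  let f' : H → B ⧸ K := fun h => QuotientAddGroup.mk (f (s h))
  have hf' : ∀ x, f' (π x) = QuotientAddGroup.mk (f x) := by
    intro x
    have hr : (s (π x))⁻¹ * x ∈ π.ker := by
      simp [MonoidHom.mem_ker, s, Function.surjInv_eq hπ]
    have := hker (s (π x)) _ hr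
    rw [mul_inv_cancel_left] at this
    have hK : f ((s (π x))⁻¹ * x) ∈ K := ⟨_, hr, rfl⟩
    rw [this, QuotientAddGroup.mk_add, (QuotientAddGroup.eq_zero_iff _).2 hK, add_zero]
  have hpoly : IsPolyLT k f' := by
    refine IsPolyLT.of_comp hπ ?_
    simp only [hf']
    exact hf.map (QuotientAddGroup.mk' K)
  have := hpoly.linExt_eq_zero hw
  rw [map_sub, linExt_one, MonoidAlgebra.of_apply, linExt_single, one_smul, hf',
    ← map_one π, hf', hf1, QuotientAddGroup.mk_zero, sub_zero, QuotientAddGroup.eq_zero_iff] at this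
  obtain ⟨r, hr, h⟩ := this
  exact ⟨r, hr, h.symm⟩

end AugmentationIdeal

/-! ### The Magnus expansion truncated in degree four -/

/-- Noncommutative power series in the variables `ι` with constant term `1`, truncated in
degree four: `c₁ a`, `c₂ a b`, `c₃ a b c` are the coefficients of `X_a`, `X_a X_b`,
`X_a X_b X_c`. -/
@[ext]
structure TruncSeries (ι : Type*) where
  c₁ : ι → ℤ
  c₂ : ι → ι → ℤ
  c₃ : ι → ι → ι → ℤ

namespace TruncSeries

variable {ι : Type*}

instance : Mul (TruncSeries ι) where
  mul x y :=
    { c₁ := fun a => x.c₁ a + y.c₁ a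
      c₂ := fun a b => x.c₂ a b + y.c₂ a b + x.c₁ a * y.c₁ b
      c₃ := fun a b c => x.c₃ a b c + y.c₃ a b c + x.c₂ a b * y.c₁ c + x.c₁ a * y.c₂ b c }

instance : One (TruncSeries ι) := ⟨⟨0, 0, 0⟩⟩

/-- The geometric series 1 - X + X² - X³, with X the part of positive degree. -/
instance : Inv (TruncSeries ι) where
  inv x :=
    { c₁ := fun a => -x.c₁ a
      c₂ := fun a b => -x.c₂ a b + x.c₁ a * x.c₁ b
      c₃ := fun a b c => -x.c₃ a b c + x.c₂ a b * x.c₁ c + x.c₁ a * x.c₂ b c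
        - x.c₁ a * x.c₁ b * x.c₁ c }

lemma mul_c₁ (x y : TruncSeries ι) (a : ι) : (x * y).c₁ a = x.c₁ a + y.c₁ a := rfl

lemma mul_c₂ (x y : TruncSeries ι) (a b : ι) :
    (x * y).c₂ a b = x.c₂ a b + y.c₂ a b + x.c₁ a * y.c₁ b := rfl

lemma mul_c₃ (x y : TruncSeries ι) (a b c : ι) : (x * y).c₃ a b c =
    x.c₃ a b c + y.c₃ a b c + x.c₂ a b * y.c₁ c + x.c₁ a * y.c₂ b c := rfl

lemma one_c₁ (a : ι) : (1 : TruncSeries ι).c₁ a = 0 := rfl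

lemma one_c₂ (a b : ι) : (1 : TruncSeries ι).c₂ a b = 0 := rfl

lemma one_c₃ (a b c : ι) : (1 : TruncSeries ι).c₃ a b c = 0 := rfl

lemma inv_c₁ (x : TruncSeries ι) (a : ι) : (x⁻¹).c₁ a = -x.c₁ a := rfl

lemma inv_c₂ (x : TruncSeries ι) (a b : ι) :
    (x⁻¹).c₂ a b = -x.c₂ a b + x.c₁ a * x.c₁ b := rfl

lemma inv_c₃ (x : TruncSeries ι) (a b c : ι) : (x⁻¹).c₃ a b c =
    -x.c₃ a b c + x.c₂ a b * x.c₁ c + x.c₁ a * x.c₂ b c - x.c₁ a * x.c₁ b * x.c₁ c := rfl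

instance : Group (TruncSeries ι) :=
  Group.ofLeftAxioms
    (fun x y z => by ext <;> simp only [mul_c₁, mul_c₂, mul_c₃] <;> ring)
    (fun x => by
      ext <;> simp only [mul_c₁, mul_c₂, mul_c₃, one_c₁, one_c₂, one_c₃] <;> ring)
    (fun x => by
      ext <;> simp only [mul_c₁, mul_c₂, mul_c₃, one_c₁, one_c₂, one_c₃, inv_c₁, inv_c₂,
        inv_c₃] <;> ring)

end TruncSeries

section Magnus

variable {ι : Type*} [DecidableEq ι]

/-- The truncated Magnus expansion `x_a ↦ 1 + X_a`. -/
def magnus (ι : Type*) [DecidableEq ι] : FreeGroup ι →* TruncSeries ι :=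
  FreeGroup.lift fun i => ⟨Pi.single i 1, 0, 0⟩

/-- The coefficient of `X_a` in the Magnus expansion. -/
def magnus₁ (w : FreeGroup ι) (a : ι) : ℤ := (magnus ι w).c₁ a

/-- The coefficient of `X_a X_b` in the Magnus expansion. -/
def magnus₂ (w : FreeGroup ι) (a b : ι) : ℤ := (magnus ι w).c₂ a b

/-- The coefficient of `X_a X_b X_c` in the Magnus expansion. -/
def magnus₃ (w : FreeGroup ι) (a b c : ι) : ℤ := (magnus ι w).c₃ a b c

lemma magnus₁_of (i a : ι) : magnus₁ (FreeGroup.of i) a = if a = i then 1 else 0 := by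
  simp [magnus₁, magnus, Pi.single_apply]

lemma magnus₁_mul (v w : FreeGroup ι) (a : ι) :
    magnus₁ (v * w) a = magnus₁ v a + magnus₁ w a := by
  simp only [magnus₁, map_mul, TruncSeries.mul_c₁]

lemma magnus₂_mul (v w : FreeGroup ι) (a b : ι) :
    magnus₂ (v * w) a b = magnus₂ v a b + magnus₂ w a b + magnus₁ v a * magnus₁ w b := by
  simp only [magnus₁, magnus₂, map_mul, TruncSeries.mul_c₂]

lemma magnus₃_mul (v w : FreeGroup ι) (a b c : ι) :
    magnus₃ (v * w) a b c = magnus₃ v a b c + magnus₃ w a b c + magnus₂ v a b * magnus₁ w c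
      + magnus₁ v a * magnus₂ w b c := by
  simp only [magnus₁, magnus₂, magnus₃, map_mul, TruncSeries.mul_c₃]

lemma magnus₂_mul_of_magnus₁_eq_zero (w : FreeGroup ι) {r : FreeGroup ι}
    (hr : ∀ a, magnus₁ r a = 0) : magnus₂ (w * r) = magnus₂ w + magnus₂ r := by
  ext a b
  simp [magnus₂_mul, hr]

lemma magnus₁_one (a : ι) : magnus₁ 1 a = 0 := by
  simp only [magnus₁, map_one, TruncSeries.one_c₁]

/-- In each degree, the product formula shows that the difference of a Magnus coefficient involves
only coefficients of lower degree. -/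
lemma isPolyLT_magnus₁ (a : ι) : IsPolyLT 2 (fun w => magnus₁ w a) := by
  intro h
  convert IsPolyLT.const 0 (magnus₁ h a) using 2
  simp only [magnus₁_mul]; ring

lemma isPolyLT_magnus₂ (a b : ι) : IsPolyLT 3 (fun w => magnus₂ w a b) := by
  intro h
  convert (IsPolyLT.const 1 (magnus₂ h a b)).add ((isPolyLT_magnus₁ a).mul_const (magnus₁ h b))
    using 2
  simp only [magnus₂_mul]; ring

lemma isPolyLT_magnus₃ (a b c : ι) : IsPolyLT 4 (fun w => magnus₃ w a b c) := by
  intro h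
  convert ((IsPolyLT.const 2 (magnus₃ h a b c)).add
    ((isPolyLT_magnus₂ a b).mul_const (magnus₁ h c))).add
      ((isPolyLT_magnus₁ a).succ.mul_const (magnus₂ h b c)) using 2
  simp only [magnus₃_mul]; ring

/-- Comparing coefficients in ⁅v, w⁆ (w v) = v w avoids inverses; the higher degrees are treated the
same way. -/
lemma magnus₁_commutator (v w : FreeGroup ι) (a : ι) : magnus₁ ⁅v, w⁆ a = 0 := by
  have h := magnus₁_mul ⁅v, w⁆ (w * v) a
  rw [show ⁅v, w⁆ * (w * v) = v * w by simp [commutatorElement_def, mul_assoc], magnus₁_mul,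
    magnus₁_mul] at h
  linarith

lemma magnus₂_commutator (v w : FreeGroup ι) (a b : ι) :
    magnus₂ ⁅v, w⁆ a b = magnus₁ v a * magnus₁ w b - magnus₁ w a * magnus₁ v b := by
  have h := magnus₂_mul ⁅v, w⁆ (w * v) a b
  rw [show ⁅v, w⁆ * (w * v) = v * w by simp [commutatorElement_def, mul_assoc], magnus₂_mul,
    magnus₂_mul, magnus₁_commutator] at h
  linarith

/-- The Magnus expansion of `⁅v, w⁆` in degree three, for `v` in the commutator subgroup. -/
lemma magnus₃_commutator {v : FreeGroup ι} (hv : ∀ a, magnus₁ v a = 0) (w : FreeGroup ι)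
    (a b c : ι) : magnus₃ ⁅v, w⁆ a b c =
      magnus₂ v a b * magnus₁ w c - magnus₁ w a * magnus₂ v b c := by
  have h := magnus₃_mul ⁅v, w⁆ (w * v) a b c
  rw [show ⁅v, w⁆ * (w * v) = v * w by simp [commutatorElement_def, mul_assoc], magnus₃_mul,
    magnus₃_mul, magnus₁_commutator, magnus₂_commutator] at h
  simp only [hv] at h
  linarith

lemma magnus₁_eq_zero_of_mem {w : FreeGroup ι}
    (hw : w ∈ (⊤ : Subgroup (FreeGroup ι)).lowerCentralSeries 1) (a : ι) : magnus₁ w a = 0 := by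
  rw [Subgroup.mem_lowerCentralSeries_succ_iff] at hw
  induction hw using Subgroup.closure_induction with
  | mem x hx => obtain ⟨p, -, q, -, rfl⟩ := hx; exact magnus₁_commutator p q a
  | one => exact magnus₁_one a
  | mul x y _ _ hx hy => rw [magnus₁_mul, hx, hy, add_zero]
  | inv x _ hx =>
    have h := magnus₁_mul x x⁻¹ a
    rw [mul_inv_cancel, magnus₁_one, hx] at h
    linarith

/-- A homomorphism from a free group to an abelian group is determined by exponent sums. -/
lemma eq_sum_magnus₁_smul [Fintype ι] {A : Type*} [AddCommGroup A] {f : FreeGroup ι → A}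
    (hf : ∀ v w, f (v * w) = f v + f w) (w : FreeGroup ι) :
    f w = ∑ a, magnus₁ w a • f (FreeGroup.of a) := by
  let F₁ : FreeGroup ι →* Multiplicative A :=
    MonoidHom.mk' (fun w => Multiplicative.ofAdd (f w)) fun v w => by rw [hf]; rfl
  let F₂ : FreeGroup ι →* Multiplicative A :=
    MonoidHom.mk' (fun w => Multiplicative.ofAdd (∑ a, magnus₁ w a • f (FreeGroup.of a)))
      fun v w => by
        simp only [magnus₁_mul, add_smul, Finset.sum_add_distrib]; rfl
  have : F₁ = F₂ := by
    ext i
    simp [F₁, F₂, magnus₁_of]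
  exact DFunLike.congr_fun this w

/-- An element of a free group with zero exponent sums lies in the commutator subgroup. -/
lemma mem_lowerCentralSeries_one [Fintype ι] {w : FreeGroup ι} (hw : ∀ a, magnus₁ w a = 0) :
    w ∈ (⊤ : Subgroup (FreeGroup ι)).lowerCentralSeries 1 := by
  have := eq_sum_magnus₁_smul
    (f := fun w : FreeGroup ι => Additive.ofMul (Abelianization.of w))
    (fun v w => by rw [map_mul]; rfl) w
  simp only [hw, zero_smul, Finset.sum_const_zero] at this
  rw [Subgroup.top_lowerCentralSeries_one, ← Abelianization.ker_of, MonoidHom.mem_ker]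
  exact this

/-- Two functions that are additive on a term of the lower central series agree there if they
agree on the generating commutators. -/
lemma eq_of_mem_lowerCentralSeries_succ {G A : Type*} [Group G] [AddCommGroup A] {k : ℕ}
    {f f' : G → A}
    (hf : ∀ v ∈ (⊤ : Subgroup G).lowerCentralSeries (k + 1),
      ∀ w ∈ (⊤ : Subgroup G).lowerCentralSeries (k + 1), f (v * w) = f v + f w)
    (hf' : ∀ v ∈ (⊤ : Subgroup G).lowerCentralSeries (k + 1),
      ∀ w ∈ (⊤ : Subgroup G).lowerCentralSeries (k + 1), f' (v * w) = f' v + f' w)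
    (h : ∀ v ∈ (⊤ : Subgroup G).lowerCentralSeries k, ∀ w, f ⁅v, w⁆ = f' ⁅v, w⁆)
    {w : G} (hw : w ∈ (⊤ : Subgroup G).lowerCentralSeries (k + 1)) : f w = f' w := by
  have h1 : f 1 = 0 := by simpa using hf 1 (one_mem _) 1 (one_mem _)
  have h1' : f' 1 = 0 := by simpa using hf' 1 (one_mem _) 1 (one_mem _)
  rw [Subgroup.mem_lowerCentralSeries_succ_iff] at hw
  induction hw using Subgroup.closure_induction with
  | mem x hx => obtain ⟨p, hp, q, -, rfl⟩ := hx; exact h p hp q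
  | one => rw [h1, h1']
  | mul x y hx hy ihx ihy => rw [hf x hx y hy, hf' x hx y hy, ihx, ihy]
  | inv x hx ihx =>
    have e := hf x hx x⁻¹ (inv_mem hx)
    have e' := hf' x hx x⁻¹ (inv_mem hx)
    rw [mul_inv_cancel, h1] at e
    rw [mul_inv_cancel, h1', ← ihx, e] at e'
    exact add_left_cancel e'

end Magnus

/-! ### Commutators in nilpotent groups of small class -/

section Nilpotent

variable {H : Type*} [Group H]

/-- Indices are shifted: `lowerCentralSeries k` is γ_{k+1}. -/
lemma lowerCentralSeries_le_center {k : ℕ}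
    (hH : (⊤ : Subgroup H).lowerCentralSeries (k + 1) = ⊥) :
    (⊤ : Subgroup H).lowerCentralSeries k ≤ Subgroup.center H :=
  Subgroup.commutator_top_right_eq_bot_iff_le_center.1 hH

lemma commutator_mem_center {k : ℕ} (hH : (⊤ : Subgroup H).lowerCentralSeries (k + 2) = ⊥)
    {v : H} (hv : v ∈ (⊤ : Subgroup H).lowerCentralSeries k) (w : H) :
    ⁅v, w⁆ ∈ Subgroup.center H :=
  lowerCentralSeries_le_center hH (Subgroup.commutator_mem_commutator hv (Subgroup.mem_top w))

lemma commutatorElement_mul_left_of_mem_center {a b c : H} (h : ⁅b, c⁆ ∈ Subgroup.center H) :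
    ⁅a * b, c⁆ = ⁅a, c⁆ * ⁅b, c⁆ := by
  rw [commutatorElement_mul_left_eq_conj_mul, Subgroup.mem_center_iff.1 h a,
    mul_inv_cancel_right, Subgroup.mem_center_iff.1 h]

lemma commutatorElement_mul_right_of_mem_center {a b c : H} (h : ⁅a, c⁆ ∈ Subgroup.center H) :
    ⁅a, b * c⁆ = ⁅a, b⁆ * ⁅a, c⁆ := by
  rw [commutatorElement_mul_right_eq_mul_conj, mul_assoc _ b, Subgroup.mem_center_iff.1 h b,
    mul_assoc, mul_inv_cancel_right]

lemma commutatorElement_mul_left_of_center {z b c : H} (hz : z ∈ Subgroup.center H) :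
    ⁅z * b, c⁆ = ⁅b, c⁆ := by
  have h1 : ⁅z, c⁆ = 1 :=
    commutatorElement_eq_one_iff_mul_comm.2 (Subgroup.mem_center_iff.1 hz c).symm
  rw [commutatorElement_mul_left_eq_conj_mul, h1, mul_one, ← Subgroup.mem_center_iff.1 hz,
    mul_inv_cancel_right]

/-- Up to a central factor, which the outer bracket does not see, ⁅p p', q⁆ is the product of ⁅p',
q⁆ and ⁅p, q⁆. -/
lemma commutator_commutator_mul_left (hH : (⊤ : Subgroup H).lowerCentralSeries 3 = ⊥)
    (p p' q u : H) :
    ⁅⁅p * p', q⁆, u⁆ = ⁅⁅p, q⁆, u⁆ * ⁅⁅p', q⁆, u⁆ := by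
  have hp : ⁅p', q⁆ ∈ (⊤ : Subgroup H).lowerCentralSeries 1 :=
    Subgroup.commutator_mem_commutator (Subgroup.mem_top _) (Subgroup.mem_top _)
  have e : ⁅p * p', q⁆ = ⁅⁅p', q⁆, p⁆⁻¹ * (⁅p', q⁆ * ⁅p, q⁆) := by
    rw [commutatorElement_mul_left_eq_conj_mul]
    simp only [commutatorElement_def]
    group
  have hp2 : ⁅p, q⁆ ∈ (⊤ : Subgroup H).lowerCentralSeries 1 :=
    Subgroup.commutator_mem_commutator (Subgroup.mem_top _) (Subgroup.mem_top _)
  rw [e, commutatorElement_mul_left_of_center (inv_mem (commutator_mem_center hH hp p)),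
    commutatorElement_mul_left_of_mem_center (commutator_mem_center hH hp2 u),
    Subgroup.mem_center_iff.1 (commutator_mem_center hH hp2 u)]

lemma commutator_commutator_swap (hH : (⊤ : Subgroup H).lowerCentralSeries 3 = ⊥)
    (p q u : H) : ⁅⁅q, p⁆, u⁆ = ⁅⁅p, q⁆, u⁆⁻¹ := by
  have hp : ⁅p, q⁆ ∈ (⊤ : Subgroup H).lowerCentralSeries 1 :=
    Subgroup.commutator_mem_commutator (Subgroup.mem_top _) (Subgroup.mem_top _)
  rw [eq_inv_iff_mul_eq_one, ← commutatorElement_mul_left_of_mem_center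
    (commutator_mem_center hH hp u), ← commutatorElement_inv p q, inv_mul_cancel,
    commutatorElement_one_left]

/-- Bracketing with ⁅p, q⁆ is a homomorphism into the center, hence invariant under conjugation. -/
lemma commutator_commutator_conj (hH : (⊤ : Subgroup H).lowerCentralSeries 3 = ⊥)
    (p q u v : H) : ⁅⁅p, q⁆, v * u * v⁻¹⁆ = ⁅⁅p, q⁆, u⁆ := by
  have hp : ⁅p, q⁆ ∈ (⊤ : Subgroup H).lowerCentralSeries 1 :=
    Subgroup.commutator_mem_commutator (Subgroup.mem_top _) (Subgroup.mem_top _)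
  have hc := fun u => commutator_mem_center hH hp u
  rw [commutatorElement_mul_right_of_mem_center (hc _),
    commutatorElement_mul_right_of_mem_center (hc _), ← Subgroup.mem_center_iff.1 (hc v),
    mul_assoc, ← commutatorElement_mul_right_of_mem_center (hc _), mul_inv_cancel,
    commutatorElement_one_right, mul_one]

/-- This is the Hall–Witt identity, whose conjugations disappear in class three. -/
lemma commutator_commutator_jacobi (hH : (⊤ : Subgroup H).lowerCentralSeries 3 = ⊥)
    (p q u : H) :
    ⁅⁅p, q⁆, u⁆ * ⁅⁅q, u⁆, p⁆ * ⁅⁅u, p⁆, q⁆ = 1 := by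
  have := commutatorElement_commutatorElement_conj_mul p q u
  simpa only [commutator_commutator_conj hH] using this

end Nilpotent

/-! ### Trilinear data with the symmetries of an iterated bracket -/

/-- A preimage of `C` under `φ ↦ φ a b c - φ b a c` which is symmetric in the last two arguments. -/
def symmPreimage {ι A : Type*} [LinearOrder ι] [AddCommGroup A] (C : ι → ι → ι → A)
    (a b c : ι) : A :=
  if min b c < a then C a (min b c) (max b c) else 0

lemma symmPreimage_symm {ι A : Type*} [LinearOrder ι] [AddCommGroup A] (C : ι → ι → ι → A)
    (a b c : ι) : symmPreimage C a b c = symmPreimage C a c b := by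
  rw [symmPreimage, symmPreimage, min_comm, max_comm]

/-- The nonzero entries of `symmPreimage C` sit on index patterns of the basic commutators ⁅⁅x_a,
x_b⁆, x_c⁆ with a > b ≤ c; the remaining values of `C` are forced by antisymmetry and Jacobi. -/
lemma symmPreimage_sub {ι A : Type*} [LinearOrder ι] [AddCommGroup A] {C : ι → ι → ι → A}
    (hself : ∀ a c, C a a c = 0) (hswap : ∀ a b c, C b a c = -C a b c)
    (hjacobi : ∀ a b c, C a b c + C b c a + C c a b = 0) (a b c : ι) :
    symmPreimage C a b c - symmPreimage C b a c = C a b c := by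
  wlog h : a ≤ b generalizing a b
  · rw [← neg_sub, this b a (le_of_not_ge h), hswap, neg_neg]
  rcases h.eq_or_lt with rfl | h
  · rw [sub_self, hself]
  rcases lt_or_ge c a with hc | hc
  -- For c < a < b both terms survive and Jacobi is needed; for a ≤ c only the second one does, and
  -- antisymmetry suffices.
  · have h1 : c < b := hc.trans h
    have e : C a c b - C b c a = C a b c := by
      have j := hjacobi a b c
      rw [hswap a c b] at j
      rw [← sub_eq_zero, ← neg_eq_zero, ← j]
      abel
    simpa [symmPreimage, h1, hc, h1.le, hc.le] using e
  · have h1 : ¬ (min b c < a) := by simp [h.le, hc]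
    have e : -C b a c = C a b c := by rw [hswap, neg_neg]
    simpa [symmPreimage, h1, h, hc] using e

/-! ### Central values as elements of an additive group -/

section CenterValue

open scoped IsMulCommutative

variable {H : Type*} [Group H]

open Classical in
/-- A central element of `H`, written additively; elements outside the center are sent to `0`. -/
noncomputable def centerValue (h : H) : Additive (Subgroup.center H) :=
  if hh : h ∈ Subgroup.center H then Additive.ofMul ⟨h, hh⟩ else 0

lemma centerValue_mul {x y : H} (hx : x ∈ Subgroup.center H) (hy : y ∈ Subgroup.center H) :
    centerValue (x * y) = centerValue x + centerValue y := by
  rw [centerValue, centerValue, centerValue, dif_pos hx, dif_pos hy, dif_pos (mul_mem hx hy)]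
  rfl

lemma centerValue_one : centerValue (1 : H) = 0 := by
  rw [centerValue, dif_pos (one_mem _)]
  rfl

lemma centerValue_inv {x : H} (hx : x ∈ Subgroup.center H) :
    centerValue x⁻¹ = -centerValue x := by
  rw [eq_neg_iff_add_eq_zero, ← centerValue_mul (inv_mem hx) hx, inv_mul_cancel, centerValue_one]

lemma eq_one_of_centerValue_eq_zero {x : H} (hx : x ∈ Subgroup.center H)
    (h : centerValue x = 0) : x = 1 := by
  rw [centerValue, dif_pos hx] at h
  exact congrArg (fun z : Additive (Subgroup.center H) => (z.toMul : H)) h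

end CenterValue

/-! ### Pairing Magnus coefficients with tensors -/

section Pairing

variable {ι A : Type*} [Fintype ι] [DecidableEq ι] [AddCommGroup A]

/-- The degree two Magnus coefficients paired with `ψ`. -/
def magnusPairing₂ (ψ : ι → ι → A) (w : FreeGroup ι) : A :=
  ∑ a, ∑ b, magnus₂ w a b • ψ a b

/-- The degree three Magnus coefficients paired with `φ`. -/
def magnusPairing₃ (φ : ι → ι → ι → A) (w : FreeGroup ι) : A :=
  ∑ a, ∑ b, ∑ c, magnus₃ w a b c • φ a b c

lemma magnusPairing₂_commutator (ψ : ι → ι → A) (p q : FreeGroup ι) :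
    magnusPairing₂ ψ ⁅p, q⁆ = ∑ a, ∑ b, (magnus₁ p a * magnus₁ q b) • (ψ a b - ψ b a) := by
  simp only [magnusPairing₂, magnus₂_commutator, sub_smul, smul_sub, Finset.sum_sub_distrib]
  congr 1
  rw [Finset.sum_comm]
  refine Finset.sum_congr rfl fun a _ => Finset.sum_congr rfl fun b _ => ?_
  rw [mul_comm]

lemma magnusPairing₂_mul (ψ : ι → ι → A) {v : FreeGroup ι}
    (hv : v ∈ (⊤ : Subgroup (FreeGroup ι)).lowerCentralSeries 1) (w : FreeGroup ι) :
    magnusPairing₂ ψ (v * w) = magnusPairing₂ ψ v + magnusPairing₂ ψ w := by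
  simp only [magnusPairing₂, magnus₂_mul, magnus₁_eq_zero_of_mem hv, zero_mul, add_zero, add_smul,
    Finset.sum_add_distrib]

lemma biadditive_eq_sum {f : FreeGroup ι → FreeGroup ι → A}
    (hl : ∀ p p' q, f (p * p') q = f p q + f p' q) (hr : ∀ p q q', f p (q * q') = f p q + f p q')
    (p q : FreeGroup ι) :
    f p q = ∑ a, ∑ b, (magnus₁ p a * magnus₁ q b) • f (FreeGroup.of a) (FreeGroup.of b) := by
  rw [eq_sum_magnus₁_smul (f := fun p => f p q) (fun p p' => hl p p' q) p]
  refine Finset.sum_congr rfl fun a _ => ?_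
  rw [eq_sum_magnus₁_smul (hr (FreeGroup.of a)) q, Finset.smul_sum]
  simp only [smul_smul]

/-- On the commutator subgroup, pairing with `ψ` computes every function that is additive there
and is on commutators the biadditive function given by the antisymmetrization of `ψ`. -/
lemma magnusPairing₂_eq {ψ : ι → ι → A} {f : FreeGroup ι → A}
    (hf : ∀ v ∈ (⊤ : Subgroup (FreeGroup ι)).lowerCentralSeries 1,
      ∀ w ∈ (⊤ : Subgroup (FreeGroup ι)).lowerCentralSeries 1, f (v * w) = f v + f w)
    (hl : ∀ p p' q : FreeGroup ι, f ⁅p * p', q⁆ = f ⁅p, q⁆ + f ⁅p', q⁆)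
    (hr : ∀ p q q' : FreeGroup ι, f ⁅p, q * q'⁆ = f ⁅p, q⁆ + f ⁅p, q'⁆)
    (hψ : ∀ a b, ψ a b - ψ b a = f ⁅FreeGroup.of a, FreeGroup.of b⁆) {v : FreeGroup ι}
    (hv : v ∈ (⊤ : Subgroup (FreeGroup ι)).lowerCentralSeries 1) :
    magnusPairing₂ ψ v = f v := by
  refine eq_of_mem_lowerCentralSeries_succ (k := 0) (fun v hv w _ => magnusPairing₂_mul ψ hv w) hf
    (fun p _ q => ?_) hv
  rw [magnusPairing₂_commutator, biadditive_eq_sum (f := fun p q => f ⁅p, q⁆) hl hr]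
  simp only [hψ]

/-- Quadratic Magnus coefficients of commutators are antisymmetric. -/
lemma magnusPairing₂_eq_zero {ψ : ι → ι → A} (hψ : ∀ a b, ψ a b = ψ b a) {v : FreeGroup ι}
    (hv : v ∈ (⊤ : Subgroup (FreeGroup ι)).lowerCentralSeries 1) : magnusPairing₂ ψ v = 0 :=
  magnusPairing₂_eq (f := fun _ => 0) (by simp) (by simp) (by simp) (by simp [hψ]) hv

lemma isPolyLT_magnusPairing₃ (φ : ι → ι → ι → A) : IsPolyLT 4 (magnusPairing₃ φ) :=
  IsPolyLT.sum _ fun a => IsPolyLT.sum _ fun b => IsPolyLT.sum _ fun c =>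
    (isPolyLT_magnus₃ a b c).smul_const (φ a b c)

/-- Of the two cross terms, one contains a linear coefficient of `r`, which is zero; the other pairs
the quadratic part of `r` with the symmetric last two indices of `φ`. -/
lemma magnusPairing₃_mul {φ : ι → ι → ι → A} (hφ : ∀ a b c, φ a b c = φ a c b)
    (w : FreeGroup ι) {r : FreeGroup ι}
    (hr : r ∈ (⊤ : Subgroup (FreeGroup ι)).lowerCentralSeries 1) :
    magnusPairing₃ φ (w * r) = magnusPairing₃ φ w + magnusPairing₃ φ r := by
  have h : ∀ a, ∑ b, ∑ c, (magnus₁ w a * magnus₂ r b c) • φ a b c = 0 := by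
    intro a
    have := magnusPairing₂_eq_zero (hφ a) hr
    rw [magnusPairing₂] at this
    simp only [mul_smul, ← Finset.smul_sum, this, smul_zero]
  simp only [magnusPairing₃, magnus₃_mul, magnus₁_eq_zero_of_mem hr, mul_zero, add_zero, add_smul,
    Finset.sum_add_distrib, h]

/-- The symmetry of `φ` kills one of the two terms of the cubic part of ⁅v, w⁆, leaving the
quadratic part of `v` times the linear part of `w`. -/
lemma magnusPairing₃_commutator {φ : ι → ι → ι → A} (hφ : ∀ a b c, φ a b c = φ a c b)
    {v : FreeGroup ι} (hv : v ∈ (⊤ : Subgroup (FreeGroup ι)).lowerCentralSeries 1)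
    (w : FreeGroup ι) : magnusPairing₃ φ ⁅v, w⁆ =
      ∑ c, magnus₁ w c • magnusPairing₂ (fun a b => φ a b c) v := by
  have h : ∀ a, ∑ b, ∑ c, (magnus₁ w a * magnus₂ v b c) • φ a b c = 0 := by
    intro a
    have := magnusPairing₂_eq_zero (hφ a) hv
    rw [magnusPairing₂] at this
    simp only [mul_smul, ← Finset.smul_sum, this, smul_zero]
  simp only [magnusPairing₃, magnus₃_commutator (magnus₁_eq_zero_of_mem hv), sub_smul,
    Finset.sum_sub_distrib, h, sub_zero, magnusPairing₂, Finset.smul_sum,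
    smul_smul]
  rw [Finset.sum_comm_cycle]
  refine Finset.sum_congr rfl fun c _ => Finset.sum_congr rfl fun a _ =>
    Finset.sum_congr rfl fun b _ => ?_
  rw [mul_comm]

end Pairing

/-! ### Dimension subgroups of groups with free abelianization -/

section Free

open scoped IsMulCommutative

variable {ι : Type*} [Fintype ι] [LinearOrder ι]

lemma map_mem_lowerCentralSeries {G H : Type*} [Group G] [Group H] (π : G →* H) {k : ℕ} {w : G}
    (hw : w ∈ (⊤ : Subgroup G).lowerCentralSeries k) :
    π w ∈ (⊤ : Subgroup H).lowerCentralSeries k := by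
  have := Subgroup.mem_map_of_mem π hw
  rw [Subgroup.map_lowerCentralSeries] at this
  exact Subgroup.lowerCentralSeries_mono k le_top this

/-- Homomorphisms to a group of class two kill elements whose Magnus expansion vanishes in
degrees one and two. -/
lemma map_eq_one_of_magnus₂_eq_zero {H : Type*} [Group H]
    (hH : (⊤ : Subgroup H).lowerCentralSeries 2 = ⊥) (π : FreeGroup ι →* H) {w : FreeGroup ι}
    (hw₁ : ∀ a, magnus₁ w a = 0) (hw₂ : ∀ a b, magnus₂ w a b = 0) : π w = 1 := by
  have hw := mem_lowerCentralSeries_one hw₁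
  have hz : ∀ v ∈ (⊤ : Subgroup (FreeGroup ι)).lowerCentralSeries 1, π v ∈ Subgroup.center H :=
    fun v hv => lowerCentralSeries_le_center hH (map_mem_lowerCentralSeries π hv)
  have hc : ∀ p q : H, ⁅p, q⁆ ∈ Subgroup.center H := fun p q =>
    commutator_mem_center (k := 0) hH (Subgroup.mem_top p) q
  let C : ι → ι → Additive (Subgroup.center H) := fun a b =>
    centerValue (π ⁅FreeGroup.of a, FreeGroup.of b⁆)
  have hC : ∀ a b, C b a = -C a b := by
    intro a b
    simp only [C, map_commutatorElement]
    rw [← centerValue_inv (hc _ _), commutatorElement_inv]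
  refine eq_one_of_centerValue_eq_zero (hz w hw) ?_
  -- Taking the strictly upper triangular half of `C` gives antisymmetrization `C` without dividing
  -- by 2.
  rw [← magnusPairing₂_eq (ψ := fun a b => if a < b then C a b else 0)
    (f := fun w => centerValue (π w)) ?_ ?_ ?_ ?_ hw]
  · simp [magnusPairing₂, hw₂]
  · intro v hv w hw
    rw [map_mul, centerValue_mul (hz v hv) (hz w hw)]
  · intro p p' q
    simp only [map_commutatorElement, map_mul]
    rw [commutatorElement_mul_left_of_mem_center (hc _ _), centerValue_mul (hc _ _) (hc _ _)]
  · intro p q q'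
    simp only [map_commutatorElement, map_mul]
    rw [commutatorElement_mul_right_of_mem_center (hc _ _), centerValue_mul (hc _ _) (hc _ _)]
  · intro a b
    change _ = C a b
    rcases lt_trichotomy a b with h | rfl | h
    · simp [h, h.not_gt]
    · simp [C, centerValue_one]
    · simp [h, h.not_gt, hC b a]

lemma lowerCentralSeries_quotient_eq_bot (G : Type*) [Group G] (k : ℕ) :
    (⊤ : Subgroup (G ⧸ (⊤ : Subgroup G).lowerCentralSeries k)).lowerCentralSeries k = ⊥ := by
  have h := Subgroup.map_lowerCentralSeries (⊤ : Subgroup G)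
    (QuotientGroup.mk' ((⊤ : Subgroup G).lowerCentralSeries k)) k
  rw [Subgroup.map_top_of_surjective _ (QuotientGroup.mk'_surjective _)] at h
  rw [← h, QuotientGroup.map_mk'_self]

/-- The universal case of the preceding vanishing: the target is F/γ_3 F. -/
lemma mem_lowerCentralSeries_two {w : FreeGroup ι} (hw₁ : ∀ a, magnus₁ w a = 0)
    (hw₂ : ∀ a b, magnus₂ w a b = 0) :
    w ∈ (⊤ : Subgroup (FreeGroup ι)).lowerCentralSeries 2 := by
  rw [← QuotientGroup.eq_one_iff]
  exact map_eq_one_of_magnus₂_eq_zero (lowerCentralSeries_quotient_eq_bot _ 2)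
    (QuotientGroup.mk' _) hw₁ hw₂

/-- A homomorphism `π` to a group of class three is computed on the third term of the lower
central series by a polynomial function on the whole free group, which is additive along the
commutator subgroup. -/
lemma exists_isPolyLT_eq_centerValue {H : Type*} [Group H]
    (hH : (⊤ : Subgroup H).lowerCentralSeries 3 = ⊥) (π : FreeGroup ι →* H) :
    ∃ f : FreeGroup ι → Additive (Subgroup.center H), IsPolyLT 4 f ∧
      (∀ w, ∀ r ∈ (⊤ : Subgroup (FreeGroup ι)).lowerCentralSeries 1, f (w * r) = f w + f r) ∧
      ∀ w ∈ (⊤ : Subgroup (FreeGroup ι)).lowerCentralSeries 2, f w = centerValue (π w) := by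
  have hc : ∀ v ∈ (⊤ : Subgroup H).lowerCentralSeries 1, ∀ u, ⁅v, u⁆ ∈ Subgroup.center H :=
    fun v hv u => commutator_mem_center hH hv u
  have hcc : ∀ p q u : H, ⁅⁅p, q⁆, u⁆ ∈ Subgroup.center H := fun p q u =>
    hc _ (Subgroup.commutator_mem_commutator (Subgroup.mem_top _) (Subgroup.mem_top _)) u
  let C : ι → ι → ι → Additive (Subgroup.center H) := fun a b c =>
    centerValue ⁅π ⁅FreeGroup.of a, FreeGroup.of b⁆, π (FreeGroup.of c)⁆
  have hC : ∀ a b c, symmPreimage C a b c - symmPreimage C b a c = C a b c := by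
    refine symmPreimage_sub (fun a c => ?_) (fun a b c => ?_) (fun a b c => ?_)
    · simp [C, centerValue_one]
    · simp only [C, map_commutatorElement]
      rw [← centerValue_inv (hcc _ _ _), commutator_commutator_swap hH]
    · simp only [C, map_commutatorElement]
      rw [← centerValue_mul (hcc _ _ _) (hcc _ _ _),
        ← centerValue_mul (mul_mem (hcc _ _ _) (hcc _ _ _)) (hcc _ _ _),
        commutator_commutator_jacobi hH, centerValue_one]
  -- For fixed last index c, the slice of the tensor computes the bracket with the c-th generator on
  -- all of F'.
  have hT : ∀ c, ∀ v ∈ (⊤ : Subgroup (FreeGroup ι)).lowerCentralSeries 1,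
      magnusPairing₂ (fun a b => symmPreimage C a b c) v =
        centerValue ⁅π v, π (FreeGroup.of c)⁆ := by
    intro c v hv
    refine magnusPairing₂_eq (f := fun v => centerValue ⁅π v, π (FreeGroup.of c)⁆)
      ?_ ?_ ?_ (fun a b => hC a b c) hv
    · intro v hv w hw
      have hv' := hc _ (map_mem_lowerCentralSeries π hv) (π (FreeGroup.of c))
      have hw' := hc _ (map_mem_lowerCentralSeries π hw) (π (FreeGroup.of c))
      rw [map_mul, commutatorElement_mul_left_of_mem_center hw', centerValue_mul hv' hw']
    · intro p p' q
      simp only [map_commutatorElement, map_mul]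
      rw [commutator_commutator_mul_left hH, centerValue_mul (hcc _ _ _) (hcc _ _ _)]
    · intro p q q'
      simp only [map_commutatorElement, map_mul]
      rw [commutator_commutator_swap hH, commutator_commutator_mul_left hH, mul_inv_rev,
        ← commutator_commutator_swap hH, ← commutator_commutator_swap hH,
        centerValue_mul (hcc _ _ _) (hcc _ _ _), add_comm]
  have hsymm := symmPreimage_symm C
  refine ⟨magnusPairing₃ (symmPreimage C), isPolyLT_magnusPairing₃ _,
    fun w r hr => magnusPairing₃_mul hsymm w hr, fun w hw => ?_⟩
  have h12 : (⊤ : Subgroup (FreeGroup ι)).lowerCentralSeries 2 ≤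
      (⊤ : Subgroup (FreeGroup ι)).lowerCentralSeries 1 :=
    Subgroup.lowerCentralSeries_antitone _ one_le_two
  refine eq_of_mem_lowerCentralSeries_succ (k := 1) (f' := fun w => centerValue (π w))
    (fun v _ w hw => magnusPairing₃_mul hsymm v (h12 hw)) (fun v hv w hw => ?_)
    (fun v hv w => ?_) hw
  · rw [map_mul, centerValue_mul
      (lowerCentralSeries_le_center hH (map_mem_lowerCentralSeries π hv))
      (lowerCentralSeries_le_center hH (map_mem_lowerCentralSeries π hw))]
  -- Both sides are additive in `w`, so the generators, covered by `hT`, suffice.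
  · rw [magnusPairing₃_commutator hsymm hv]
    have hv' := hc _ (map_mem_lowerCentralSeries π hv)
    have := eq_sum_magnus₁_smul (f := fun w => centerValue ⁅π v, π w⁆) (fun u u' => by
      rw [map_mul, commutatorElement_mul_right_of_mem_center (hv' _),
        centerValue_mul (hv' _) (hv' _)]) w
    simp only [map_commutatorElement, this, hT _ v hv]

/-! ### Triviality of dimension subgroups in class at most three -/

variable {H : Type u} [Group H] {π : FreeGroup ι →* H}

lemma dimensionSubgroup_two_eq_bot (hπ : Function.Surjective π)
    (hker : ∀ r ∈ π.ker, ∀ a, magnus₁ r a = 0)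
    (hH : (⊤ : Subgroup H).lowerCentralSeries 1 = ⊥) : dimensionSubgroup H 2 = ⊥ := by
  rw [eq_bot_iff]
  intro h hh
  obtain ⟨w, rfl⟩ := hπ h
  obtain ⟨r, hr, e⟩ := exists_mem_ker_eq_of_mem_dimensionSubgroup hπ
    (f := fun w => magnus₁ w) (IsPolyLT.pi isPolyLT_magnus₁)
    (fun w r _ => funext fun a => magnus₁_mul w r a) hh
  rw [← hH]
  refine map_mem_lowerCentralSeries π (mem_lowerCentralSeries_one fun a => ?_)
  rw [e, hker r hr]

lemma dimensionSubgroup_three_eq_bot (hπ : Function.Surjective π)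
    (hker : ∀ r ∈ π.ker, ∀ a, magnus₁ r a = 0)
    (hH : (⊤ : Subgroup H).lowerCentralSeries 2 = ⊥) : dimensionSubgroup H 3 = ⊥ := by
  rw [eq_bot_iff]
  intro h hh
  obtain ⟨w, rfl⟩ := hπ h
  obtain ⟨r, hr, e⟩ := exists_mem_ker_eq_of_mem_dimensionSubgroup hπ
    (f := fun w => (magnus₁ w, magnus₂ w))
    ((IsPolyLT.pi fun a => (isPolyLT_magnus₁ a).succ).prodMk
      (IsPolyLT.pi fun a => IsPolyLT.pi fun b => isPolyLT_magnus₂ a b))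
    (fun w r hr => Prod.ext (funext fun a => magnus₁_mul w r a)
      (magnus₂_mul_of_magnus₁_eq_zero w (hker r hr))) hh
  rw [Prod.mk.injEq] at e
  -- The word `w * r⁻¹` has the same image as `w`; additivity applied to `(w * r⁻¹) * r` shows that
  -- its coefficients vanish.
  have hr' := inv_mem hr
  have h₁ : ∀ a, magnus₁ (w * r⁻¹) a = 0 := fun a => by
    rw [magnus₁_mul, hker _ hr', e.1, hker r hr, add_zero]
  have h₂ : magnus₂ (w * r⁻¹) = 0 := by
    have := magnus₂_mul_of_magnus₁_eq_zero (w * r⁻¹) (hker r hr)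
    rw [inv_mul_cancel_right, e.2] at this
    exact add_eq_right.1 this.symm
  have := map_eq_one_of_magnus₂_eq_zero hH π h₁ fun a b => by rw [h₂]; rfl
  rwa [map_mul, MonoidHom.mem_ker.1 hr', mul_one] at this

lemma dimensionSubgroup_four_eq_bot (hπ : Function.Surjective π)
    (hker : ∀ r ∈ π.ker, ∀ a, magnus₁ r a = 0)
    (hH : (⊤ : Subgroup H).lowerCentralSeries 3 = ⊥) : dimensionSubgroup H 4 = ⊥ := by
  rw [eq_bot_iff]
  intro h hh
  obtain ⟨w, rfl⟩ := hπ h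
  obtain ⟨f, hf, hfadd, hfπ⟩ := exists_isPolyLT_eq_centerValue hH π
  obtain ⟨r, hr, e⟩ := exists_mem_ker_eq_of_mem_dimensionSubgroup hπ
    (f := fun w => (magnus₁ w, magnus₂ w, f w))
    ((IsPolyLT.pi fun a => (isPolyLT_magnus₁ a).succ.succ).prodMk
      ((IsPolyLT.pi fun a => IsPolyLT.pi fun b => (isPolyLT_magnus₂ a b).succ).prodMk hf))
    (fun w r hr => Prod.ext (funext fun a => magnus₁_mul w r a)
      (Prod.ext (magnus₂_mul_of_magnus₁_eq_zero w (hker r hr))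
        (hfadd w r (mem_lowerCentralSeries_one (hker r hr))))) hh
  rw [Prod.mk.injEq, Prod.mk.injEq] at e
  have hr' := inv_mem hr
  have h₁ : ∀ a, magnus₁ (w * r⁻¹) a = 0 := fun a => by
    rw [magnus₁_mul, hker _ hr', e.1, hker r hr, add_zero]
  have h₂ : magnus₂ (w * r⁻¹) = 0 := by
    have := magnus₂_mul_of_magnus₁_eq_zero (w * r⁻¹) (hker r hr)
    rw [inv_mul_cancel_right, e.2.1] at this
    exact add_eq_right.1 this.symm
  have h₃ : f (w * r⁻¹) = 0 := by
    have := hfadd (w * r⁻¹) r (mem_lowerCentralSeries_one (hker r hr))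
    rw [inv_mul_cancel_right, e.2.2] at this
    exact add_eq_right.1 this.symm
  -- The vanishing of degrees one and two places the corrected word where `f` computes `π`.
  have hw := mem_lowerCentralSeries_two h₁ fun a b => by rw [h₂]; rfl
  rw [hfπ _ hw] at h₃
  have := eq_one_of_centerValue_eq_zero
    (lowerCentralSeries_le_center hH (map_mem_lowerCentralSeries π hw)) h₃
  rwa [map_mul, MonoidHom.mem_ker.1 hr', mul_one] at this

/-- Dimension subgroups are functorial, so triviality in the quotient confines them to its kernel.
-/
lemma dimensionSubgroup_le_of_quotient {G : Type u} [Group G] {k : ℕ}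
    (h : dimensionSubgroup (G ⧸ (⊤ : Subgroup G).lowerCentralSeries k) (k + 1) = ⊥) :
    dimensionSubgroup G (k + 1) ≤ (⊤ : Subgroup G).lowerCentralSeries k := by
  intro g hg
  have := dimensionSubgroup_map (QuotientGroup.mk' ((⊤ : Subgroup G).lowerCentralSeries k)) hg
  rw [h, Subgroup.mem_bot] at this
  exact (QuotientGroup.eq_one_iff g).1 this

end Free

/-- If `n` elements generate a group whose abelianization is free of rank `n`, then every relation
between them has zero exponent sums modulo the commutator subgroup. -/
lemma magnus₁_eq_zero_of_mem_commutator {G : Type*} [Group G] {n : ℕ}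
    (e : Additive (Abelianization G) ≃+ (Fin n → ℤ)) {g : Fin n → G}
    (hg : Subgroup.closure (Set.range g) = ⊤) {r : FreeGroup (Fin n)}
    (hr : FreeGroup.lift g r ∈ commutator G) (a : Fin n) : magnus₁ r a = 0 := by
  have hsurj : Function.Surjective (FreeGroup.lift g) := by
    rw [← MonoidHom.range_eq_top, FreeGroup.range_lift_eq_closure, hg]
  -- The map from exponent sums to the abelianization, in the basis given by `e`. It is onto because
  -- the `g a` generate.
  let φ : (Fin n → ℤ) →ₗ[ℤ] (Fin n → ℤ) :=
    Fintype.linearCombination ℤ fun a => e (Additive.ofMul (Abelianization.of (g a)))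
  have hφ : ∀ w, φ (magnus₁ w) =
      e (Additive.ofMul (Abelianization.of (FreeGroup.lift g w))) := by
    intro w
    rw [eq_sum_magnus₁_smul
      (f := fun w => e (Additive.ofMul (Abelianization.of (FreeGroup.lift g w))))
      (fun v w => by rw [map_mul, map_mul, ofMul_mul, map_add]) w]
    simp [φ, Fintype.linearCombination_apply]
  have hφs : Function.Surjective φ := by
    intro z
    obtain ⟨y, rfl⟩ := e.surjective z
    obtain ⟨x, hx⟩ := QuotientGroup.mk_surjective y.toMul
    obtain ⟨w, rfl⟩ := hsurj x
    refine ⟨magnus₁ w, ?_⟩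
    rw [hφ]
    exact congrArg e hx
  have hφi := OrzechProperty.injective_of_surjective_endomorphism φ hφs
  have : magnus₁ r = 0 := by
    apply hφi
    rw [hφ, map_zero]
    rw [← Abelianization.ker_of, MonoidHom.mem_ker] at hr
    rw [hr, ofMul_one, map_zero]
  rw [this]; rfl

/-- If `n` elements generate a group whose abelianization is free of rank `n`, then the first four
dimension subgroups are the terms of the lower central series. No condition on the second homology
is needed in this range. -/
theorem dimensionSubgroup_eq_lowerCentralSeries {G : Type u} [Group G] {n : ℕ}
    (e : Additive (Abelianization G) ≃+ (Fin n → ℤ)) {g : Fin n → G}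
    (hg : Subgroup.closure (Set.range g) = ⊤) {k : ℕ} (hk : k < 4) :
    dimensionSubgroup G (k + 1) = (⊤ : Subgroup G).lowerCentralSeries k := by
  refine le_antisymm ?_ (lowerCentralSeries_le_dimensionSubgroup k)
  rcases Nat.eq_zero_or_pos k with rfl | hk0
  · exact le_top
  refine dimensionSubgroup_le_of_quotient ?_
  have hsurj : Function.Surjective (FreeGroup.lift g) := by
    rw [← MonoidHom.range_eq_top, FreeGroup.range_lift_eq_closure, hg]
  have hπ := (QuotientGroup.mk'_surjective
    ((⊤ : Subgroup G).lowerCentralSeries k)).comp hsurj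
  rw [← MonoidHom.coe_comp] at hπ
  have hker : ∀ r ∈ ((QuotientGroup.mk' ((⊤ : Subgroup G).lowerCentralSeries k)).comp
      (FreeGroup.lift g)).ker, ∀ a, magnus₁ r a = 0 := by
    intro r hr
    -- A relation modulo γ_{k+1} is a relation modulo γ_2 because k ≥ 1; this is why k = 0 was split
    -- off.
    refine magnus₁_eq_zero_of_mem_commutator e hg ?_
    rw [← Subgroup.top_lowerCentralSeries_one]
    exact Subgroup.lowerCentralSeries_antitone _ hk0
      ((QuotientGroup.eq_one_iff _).1 (MonoidHom.mem_ker.1 hr))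
  have hH := lowerCentralSeries_quotient_eq_bot G k
  interval_cases k
  · exact dimensionSubgroup_two_eq_bot hπ hker hH
  · exact dimensionSubgroup_three_eq_bot hπ hker hH
  · exact dimensionSubgroup_four_eq_bot hπ hker hH

/-- Here `G = π₁(U, u)`, the `k`-th term `γ_k G` of the lower central series (`γ₁ G = G`) is
`(⊤ : Subgroup G).lowerCentralSeries (k - 1)`, and `MonoidAlgebra.of ℤ G g` is `g` as an element of
the group ring. -/
theorem mainTheorem4 (U : Type u) [TopologicalSpace U] [PathConnectedSpace U]
    (hCW : HasCWHomotopyType U) (u₀ : U) (n : ℕ)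
    (h₁ : Nonempty (Additive (Abelianization (FundamentalGroup U u₀)) ≃+ (Fin n → ℤ)))
    (h₂ : ∃ g : Fin n → FundamentalGroup U u₀, Subgroup.closure (Set.range g) = ⊤)
    (h₃ : Function.Injective (singComult U))
    (k : ℕ) (hk₁ : 1 ≤ k) (hk₄ : k ≤ 4) :
    (((⊤ : Subgroup (FundamentalGroup U u₀)).lowerCentralSeries (k - 1) :
        Subgroup (FundamentalGroup U u₀)) : Set (FundamentalGroup U u₀)) =
      {g | MonoidAlgebra.of ℤ (FundamentalGroup U u₀) g - 1 ∈
        augmentationIdeal (FundamentalGroup U u₀) ^ k} := by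
  obtain ⟨e⟩ := h₁
  obtain ⟨g, hg⟩ := h₂
  obtain ⟨k, rfl⟩ := Nat.exists_eq_add_of_le' hk₁
  rw [Nat.add_sub_cancel, ← dimensionSubgroup_eq_lowerCentralSeries e hg (by lia)]
  rfl
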